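/- Let $k$ be a field of characteristic $2$. For $n \ge 0$ let $$\mathrm{PER}^*_n = \sum_{\pi} \prod_{i \in \mathrm{dom}(\pi)} X_{i\,\pi(i)} \in k[X_{ij} : 1 \le i,j \le n],$$ where $\pi$ ranges over all injective partial maps from $[n]=\{1,\dots,n\}$ to $[n]$ (injective maps from a subset $\mathrm{dom}(\pi)$ of $[n]$ to $[n]$), and let $\mathrm{DET}_n$ be the determinant of the $n \times n$ matrix of indeterminates. An arithmetic circuit over $k$ is a finite directed acyclic graph (double arrows allowed) whose vertices, called gates, have in-degree $0$ (inputs, labelled by a constant of $k$ or a variable) or $2$ (labelled by $+$ or $\times$), with exactly one vertex of out-degree $0$, the output; it computes the polynomial obtained at its output, and its size is its total number of gates. The sub-circuit associated to a gate $\beta$ consists of all gates from which there is a directed path to $\beta$, including $\beta$. The circuit is weakly-skew if every multiplication gate $\alpha$ has an argument $\beta$ whose associated sub-circuit is connected to the rest of the circuit only by the arrow from $\beta$ to $\alpha$. A family $(f_n)$ of polynomials is in $\mathrm{VP}_{ws}$ over $k$ if there is a polynomial $p$ such that, for every $n$, $f_n$ is computed by a weakly-skew circuit over $k$ of size at most $p(n)$.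 Then the family $\big((\mathrm{PER}^*_n)^2\big)_{n}$ is in $\mathrm{VP}_{ws}$ over $k$. Moreover, for every $n$, the polynomial $(\mathrm{PER}^*_n)^2$ is a projection of $\mathrm{DET}_{2n}$, that is, it is obtained from $\mathrm{DET}_{2n}$ by substituting a constant of $k$ or a variable $X_{ij}$ ($1\le i,j\le n$) for each of its variables. -/

import Mathlib

/-- The label of a gate of an arithmetic circuit with set of gates `G`: an input labelled by a
constant or a variable, or a computation gate, together with its two arguments (which may
coincide, so that the underlying digraph may have double arrows). -/
inductive GateLabel (k : Type*) (σ : Type*) (G : Type*) where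
  | const (c : k)
  | var (x : σ)
  | add (l r : G)
  | mul (l r : G)

/-- The gate from which the arrow in slot `s` comes (`true` is the left slot and `false` the
right one); input gates receive no arrow. -/
def GateLabel.arg {k σ G : Type*} : GateLabel k σ G → Bool → Option G
  | .const _, _ => none
  | .var _, _ => none
  | .add l r, s => some (cond s l r)
  | .mul l r, s => some (cond s l r)

/-- An arithmetic circuit with constants in `k` and variables in `σ`: a finite directed acyclic
graph with vertices of in-degree `0` (inputs) or `2` (computation gates), and exactly one vertex
of out-degree `0`, the output. -/
structure ArithCircuit (k : Type*) (σ : Type*) where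
  Gate : Type
  [fintypeGate : Fintype Gate]
  label : Gate → GateLabel k σ Gate
  acyclic : ∀ g, ¬ Relation.TransGen (fun a b => ∃ s, (label b).arg s = some a) g g
  output : Gate
  eq_output_iff : ∀ g, g = output ↔ ∀ h s, (label h).arg s ≠ some g

namespace ArithCircuit

variable {k σ : Type*}

/-- There is an arrow from `a` to `b`, in slot `s` of `b`. -/
def ArrowAt (C : ArithCircuit k σ) (a : C.Gate) (s : Bool) (b : C.Gate) : Prop :=
  (C.label b).arg s = some a

/-- There is an arrow from `a` to `b`. -/
def Arrow (C : ArithCircuit k σ) (a b : C.Gate) : Prop := ∃ s, C.ArrowAt a s b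

theorem wellFounded_arrow (C : ArithCircuit k σ) : WellFounded C.Arrow := by
  have := C.fintypeGate
  have : Std.Irrefl (Relation.TransGen C.Arrow) := ⟨C.acyclic⟩
  exact Subrelation.wf (fun h => Relation.TransGen.single h)
    (Finite.wellFounded_of_trans_of_irrefl (Relation.TransGen C.Arrow))

/-- The polynomial computed at each gate. -/
noncomputable def value [CommSemiring k] (C : ArithCircuit k σ) : C.Gate → MvPolynomial σ k :=
  C.wellFounded_arrow.fix fun g ih =>
    match h : C.label g with
    | .const c => MvPolynomial.C c
    | .var x => MvPolynomial.X x
    | .add l r =>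
        ih l ⟨true, by simp [ArrowAt, h, GateLabel.arg]⟩ +
          ih r ⟨false, by simp [ArrowAt, h, GateLabel.arg]⟩
    | .mul l r =>
        ih l ⟨true, by simp [ArrowAt, h, GateLabel.arg]⟩ *
          ih r ⟨false, by simp [ArrowAt, h, GateLabel.arg]⟩

theorem value_eq [CommSemiring k] (C : ArithCircuit k σ) (g : C.Gate) :
    C.value g = match C.label g with
      | .const c => MvPolynomial.C c
      | .var x => MvPolynomial.X x
      | .add l r => C.value l + C.value r
      | .mul l r => C.value l * C.value r := by
  rw [value, WellFounded.fix_eq]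
  split <;> simp_all

/-- The polynomial computed by a circuit. -/
noncomputable def poly [CommSemiring k] (C : ArithCircuit k σ) : MvPolynomial σ k :=
  C.value C.output

/-- The fat size of a circuit: its total number of gates, including the inputs. -/
def fatSize (C : ArithCircuit k σ) : ℕ := haveI := C.fintypeGate; Fintype.card C.Gate

/-- The sub-circuit associated to `a`: the gates from which there is an oriented path to `a`,
including `a` itself. -/
def subCircuit (C : ArithCircuit k σ) (a : C.Gate) : Set C.Gate :=
  {b | Relation.ReflTransGen C.Arrow b a}

/-- The sub-circuit associated to `b` is connected to the rest of the circuit only by the arrow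
from `b` to `a` in slot `s`. (No arrow enters a sub-circuit from outside, so only the outgoing
arrows have to be considered.) -/
def ClosedVia (C : ArithCircuit k σ) (b : C.Gate) (s : Bool) (a : C.Gate) : Prop :=
  ∀ x t y, C.ArrowAt x t y → x ∈ C.subCircuit b → y ∉ C.subCircuit b →
    x = b ∧ t = s ∧ y = a

/-- A circuit is weakly-skew if, for every multiplication gate, the sub-circuit associated to
one of its two arguments is closed. -/
def WeaklySkew (C : ArithCircuit k σ) : Prop :=
  ∀ a l r, C.label a = .mul l r → C.ClosedVia l true a ∨ C.ClosedVia r false a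

end ArithCircuit

/-- The class `VP_ws` over `k`: families of polynomials computed by weakly-skew circuits of
polynomially bounded size. -/
def InVPws {k : Type*} [CommSemiring k] {σ : ℕ → Type*} (f : ∀ n, MvPolynomial (σ n) k) : Prop :=
  ∃ p : Polynomial ℕ, ∀ n, ∃ C : ArithCircuit k (σ n),
    C.WeaklySkew ∧ C.poly = f n ∧ C.fatSize ≤ p.eval n

/-- `f` is a projection of `g`: it is obtained from `g` by substituting a constant or a variable
for each variable. -/
def IsProjectionOf {k σ τ : Type*} [CommSemiring k]
    (f : MvPolynomial σ k) (g : MvPolynomial τ k) : Prop :=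
  ∃ a : τ → MvPolynomial σ k,
    (∀ t, (∃ c, a t = MvPolynomial.C c) ∨ ∃ x, a t = MvPolynomial.X x) ∧
      f = MvPolynomial.aeval a g

/-- The partial permanent: the sum ranges over the injective partial maps from `[n]` to `[n]`,
that is, over the injective maps from subsets `S` of `[n]` to `[n]`. -/
noncomputable def partialPermanent {R : Type*} [CommSemiring R] {n : ℕ} (A : Matrix (Fin n) (Fin n) R) : R :=
  ∑ S : Finset (Fin n), ∑ π : S ↪ Fin n, ∏ i : S, A i (π i)

/-- The polynomial `PER*_n` in the `n ^ 2` indeterminates `X_{ij}`. -/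
noncomputable def perStar (k : Type*) [CommSemiring k] (n : ℕ) :
    MvPolynomial (Fin n × Fin n) k :=
  partialPermanent (Matrix.mvPolynomialX (Fin n) (Fin n) k)

/-- The polynomial `DET_n` in the `n ^ 2` indeterminates `X_{ij}`. -/
noncomputable def detPoly (k : Type*) [CommRing k] (n : ℕ) : MvPolynomial (Fin n × Fin n) k :=
  (Matrix.mvPolynomialX (Fin n) (Fin n) k).det

/-! In characteristic two signs disappear, and for a symmetric matrix the terms of `σ` and `σ⁻¹`
cancel unless `σ` is an involution. In the symmetric block matrix with blocks `1, A, Aᵀ, 1`, the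
involutions that avoid the zeros of the identity blocks fix each point or move it to the other side,
so they are the partial injections `π`. Each contributes the square of its term in the partial
permanent, and squaring is additive: this is `partialPermanent_sq`. The entries being constants or
variables, it gives the projection.

For `VP_ws` it remains to compute determinants by small weakly-skew circuits. Up to sign, `det M` is
the top coefficient of `det (1 - X M)`. Enlarging the leading block `D` by one row and column
subtracts a term built from `X r adj D`, with `r` the new row (`det_leadingBlock_succ`). That row
vector satisfies a fixed-point equation whose right side carries a factor `X`
(`borderSum_eq_borderRow`), so its coefficients follow by recursion on the degree, without division.
Every step has the form `f u + x * f v` with `x` a constant or a variable; giving each product its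
own copy of `x` makes the circuit weakly-skew. -/

/-- In characteristic two the determinant of a symmetric matrix is the sum over the involutive
permutations only. -/
theorem Matrix.IsSymm.det_eq_sum_involutive {R ι : Type*} [CommRing R] [CharP R 2] [Fintype ι]
    [DecidableEq ι] {M : Matrix ι ι R} (hM : M.IsSymm) :
    M.det = ∑ σ : Equiv.Perm ι with σ⁻¹ = σ, ∏ i, M i (σ i) := by
  have h1 : M.det = ∑ σ : Equiv.Perm ι, ∏ i, M i (σ i) := by
    rw [Matrix.det_apply]
    refine Finset.sum_congr rfl fun σ _ => ?_
    have : ∏ i, M (σ i) i = ∏ i, M i (σ i) :=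
      Finset.prod_congr rfl fun i _ => hM.apply _ _
    rw [this]
    rcases Int.units_eq_one_or (Equiv.Perm.sign σ) with h | h <;>
      simp [h, CharTwo.neg_eq, Units.smul_def]
  rw [h1, ← Finset.sum_filter_add_sum_filter_not _ (fun σ : Equiv.Perm ι => σ⁻¹ = σ),
    add_eq_left]
  refine Finset.sum_involution (fun σ _ => σ⁻¹) ?_ ?_ ?_ ?_
  · intro σ _
    have : ∏ i, M i (σ⁻¹ i) = ∏ i, M i (σ i) := by
      rw [← Equiv.prod_comp σ]
      exact Finset.prod_congr rfl fun i _ => by simp [hM.apply]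
    rw [this, CharTwo.add_self_eq_zero]
  · intro σ h _
    simpa using h
  · intro σ h
    simpa [eq_comm] using h
  · intro σ _
    simp

/-! ### Partial injections as involutions -/

/-- The involution of `α ⊕ β` that exchanges each `i ∈ S` with its image under `π`. -/
noncomputable def matchingFun {α β : Type*} (S : Finset α) (π : S ↪ β) : α ⊕ β → α ⊕ β :=
  open Classical in
  Sum.elim (fun i => if h : i ∈ S then .inr (π ⟨i, h⟩) else .inl i)
    (fun j => if h : ∃ i, π i = j then .inl (h.choose : α) else .inr j)

section matching

variable {α β : Type*} {S : Finset α} {π : S ↪ β}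

theorem matchingFun_inl_of_mem (i : S) : matchingFun S π (.inl i) = .inr (π i) := by
  simp [matchingFun]

theorem matchingFun_inl_of_notMem {i : α} (h : i ∉ S) : matchingFun S π (.inl i) = .inl i := by
  simp [matchingFun, h]

theorem matchingFun_inr_apply (i : S) : matchingFun S π (.inr (π i)) = .inl (i : α) := by
  have h : ∃ i', π i' = π i := ⟨i, rfl⟩
  have : h.choose = i := π.injective h.choose_spec
  simp only [matchingFun, Sum.elim_inr, dif_pos h, this]

theorem matchingFun_inr_of_forall_ne {j : β} (h : ∀ i, π i ≠ j) :
    matchingFun S π (.inr j) = .inr j := by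
  simp [matchingFun, h]

theorem matchingFun_involutive : Function.Involutive (matchingFun S π) := by
  rintro (i | j)
  · by_cases h : i ∈ S
    · rw [matchingFun_inl_of_mem ⟨i, h⟩, matchingFun_inr_apply]
    · rw [matchingFun_inl_of_notMem h, matchingFun_inl_of_notMem h]
  · by_cases h : ∃ i, π i = j
    · obtain ⟨i, rfl⟩ := h
      rw [matchingFun_inr_apply, matchingFun_inl_of_mem]
    · push Not at h
      rw [matchingFun_inr_of_forall_ne h, matchingFun_inr_of_forall_ne h]

/-- Each exchanged pair meets the same entry once in `A` and once in its transpose; fixed points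
meet a diagonal `1`. -/
theorem prod_fromBlocks_matchingFun {R : Type*} [CommSemiring R] [Fintype α] [Fintype β]
    [DecidableEq α] [DecidableEq β] (A : Matrix α β R) :
    ∏ x, Matrix.fromBlocks 1 A A.transpose 1 x (matchingFun S π x) =
      (∏ i : S, A i (π i)) ^ 2 := by
  rw [Fintype.prod_sum_type, sq]
  congr 1
  · rw [← Finset.prod_subset (Finset.subset_univ S), ← Finset.prod_coe_sort S]
    · exact Finset.prod_congr rfl fun i _ => by simp [matchingFun_inl_of_mem]
    · intro i _ hi
      simp [matchingFun_inl_of_notMem hi]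
  · rw [← Finset.prod_subset (Finset.subset_univ (Finset.univ.map π)), Finset.prod_map]
    · exact Finset.prod_congr rfl fun i _ => by simp [matchingFun_inr_apply]
    · intro j _ hj
      rw [matchingFun_inr_of_forall_ne (by simpa using hj)]
      simp

end matching

/-- A point that stays on its side is fixed, so the crossing pairs determine `f`; `S` collects the
left points that cross. -/
theorem exists_matchingFun_eq {α β : Type*} [Fintype α] {f : α ⊕ β → α ⊕ β}
    (hf : Function.Involutive f) (hl : ∀ i i', f (.inl i) = .inl i' → i = i')
    (hr : ∀ j j', f (.inr j) = .inr j' → j = j') :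
    ∃ (S : Finset α) (π : S ↪ β), matchingFun S π = f := by
  classical
  set S : Finset α := Finset.univ.filter fun i => ∃ j, f (.inl i) = .inr j
  have hS : ∀ i : S, ∃ j, f (.inl i) = .inr j := fun i => (Finset.mem_filter.1 i.2).2
  choose p hp using hS
  have hinj : Function.Injective p := fun i i' h => by
    have : f (.inl i) = f (.inl i') := by rw [hp, hp, h]
    exact Subtype.ext (Sum.inl_injective (hf.injective this))
  refine ⟨S, ⟨p, hinj⟩, funext ?_⟩
  rintro (i | j)
  · by_cases h : i ∈ S
    · rw [matchingFun_inl_of_mem ⟨i, h⟩, hp ⟨i, h⟩]; rfl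
    · rw [matchingFun_inl_of_notMem h]
      rcases hfi : f (.inl i) with i' | j
      · rw [hl i i' hfi]
      · exact absurd (Finset.mem_filter.2 ⟨Finset.mem_univ _, j, hfi⟩) h
  · rcases hfj : f (.inr j) with i | j'
    · have hi : f (.inl i) = .inr j := by rw [← hfj, hf]
      have hiS : i ∈ S := Finset.mem_filter.2 ⟨Finset.mem_univ _, j, hi⟩
      have : p ⟨i, hiS⟩ = j := Sum.inr_injective ((hp ⟨i, hiS⟩).symm.trans hi)
      rw [← this]
      exact matchingFun_inr_apply (π := ⟨p, hinj⟩) ⟨i, hiS⟩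
    · rw [matchingFun_inr_of_forall_ne, hr j j' hfj]
      rintro i rfl
      have : f (.inr (p i)) = .inl (i : α) := by rw [← hp, hf]
      simp_all

theorem matchingFun_injective {α β : Type*} {x y : Σ S : Finset α, (S ↪ β)}
    (h : matchingFun x.1 x.2 = matchingFun y.1 y.2) : x = y := by
  obtain ⟨S, π⟩ := x
  obtain ⟨T, ρ⟩ := y
  have key : ∀ {S T : Finset α} {π : S ↪ β} {ρ : T ↪ β}, matchingFun S π = matchingFun T ρ →
      S ⊆ T := by
    intro S T π ρ h i hi
    by_contra hT
    have := congrFun h (.inl i)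
    rw [matchingFun_inl_of_mem ⟨i, hi⟩, matchingFun_inl_of_notMem hT] at this
    cases this
  obtain rfl : S = T := (key h).antisymm (key h.symm)
  congr 1
  ext i
  have := congrFun h (.inl i)
  simpa only [matchingFun_inl_of_mem, Sum.inr.injEq] using this

/-- In characteristic two the square of the partial permanent is a determinant. -/
theorem partialPermanent_sq {R : Type*} [CommRing R] [CharP R 2] {n : ℕ}
    (A : Matrix (Fin n) (Fin n) R) :
    partialPermanent A ^ 2 = (Matrix.fromBlocks 1 A A.transpose 1).det := by
  have hsymm : (Matrix.fromBlocks 1 A A.transpose 1).IsSymm := by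
    simp [Matrix.IsSymm, Matrix.fromBlocks_transpose]
  rw [hsymm.det_eq_sum_involutive, partialPermanent, CharTwo.sum_sq]
  simp_rw [CharTwo.sum_sq, ← prod_fromBlocks_matchingFun]
  rw [← Fintype.sum_sigma' (fun S : Finset (Fin n) => fun π : S ↪ Fin n =>
    ∏ x, Matrix.fromBlocks 1 A A.transpose 1 x (matchingFun S π x))]
  -- Only nonzero terms need matching: an involution moving a point within its own side meets an
  -- off-diagonal zero of an identity block.
  refine Finset.sum_bij_ne_zero (fun x _ _ => matchingFun_involutive (S := x.1) (π := x.2).toPerm)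
    ?_ ?_ ?_ ?_
  · intro x _ _
    simp only [Finset.mem_filter, Finset.mem_univ, true_and]
    rfl
  · intro x _ _ y _ _ h
    exact matchingFun_injective (congrArg DFunLike.coe h)
  · intro σ hσ h0
    have hσ' : Function.Involutive σ := fun x => by
      have h : σ⁻¹ = σ := by simpa using hσ
      nth_rewrite 1 [← h]
      simp
    have hne : ∀ x, Matrix.fromBlocks 1 A A.transpose 1 x (σ x) ≠ 0 := fun x hx =>
      h0 (Finset.prod_eq_zero (Finset.mem_univ x) hx)
    obtain ⟨S, π, h⟩ := exists_matchingFun_eq hσ'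
      (fun i i' h => by
        by_contra hi
        exact hne (.inl i) (by simp [h, hi]))
      (fun i i' h => by
        by_contra hi
        exact hne (.inr i) (by simp [h, hi]))
    refine ⟨⟨S, π⟩, Finset.mem_univ _, ?_, ?_⟩
    · simpa only [h] using h0
    · ext x
      simp [← h]
  · intro x _ _
    rfl

theorem perStar_sq_isProjectionOf (k : Type*) [Field k] [CharP k 2] (n : ℕ) :
    IsProjectionOf (perStar k n ^ 2) (detPoly k (2 * n)) := by
  let e : Fin n ⊕ Fin n ≃ Fin (2 * n) := finSumFinEquiv.trans (finCongr (two_mul n).symm)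
  let X := Matrix.mvPolynomialX (Fin n) (Fin n) k
  let B : Matrix (Fin (2 * n)) (Fin (2 * n)) (MvPolynomial (Fin n × Fin n) k) :=
    Matrix.reindex e e (Matrix.fromBlocks 1 X X.transpose 1)
  refine ⟨fun t => B t.1 t.2, fun t => ?_, ?_⟩
  · have h1 : ∀ i j, ∃ c, (1 : Matrix (Fin n) (Fin n) (MvPolynomial (Fin n × Fin n) k)) i j =
        MvPolynomial.C c := fun i j => by
      rw [Matrix.one_apply]
      split_ifs
      · exact ⟨1, by simp⟩
      · exact ⟨0, by simp⟩
    simp only [B, Matrix.reindex_apply, Matrix.submatrix_apply]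
    rcases e.symm t.1 with i | i <;> rcases e.symm t.2 with j | j
    · exact Or.inl (h1 i j)
    · exact Or.inr ⟨(i, j), by simp [X]⟩
    · exact Or.inr ⟨(j, i), by simp [X]⟩
    · exact Or.inl (h1 i j)
  · rw [perStar, partialPermanent_sq, ← Matrix.det_reindex_self e, detPoly, AlgHom.map_det]
    congr 1
    ext1 i j
    simp [B, X, Matrix.mvPolynomialX_apply]

/-! ### Weakly-skew circuits from straight-line programs -/

/-- Pruning: a gate of a possibly infinite straight-line program, in which every multiplication
gate has a private input gate as its left argument, is computed by a weakly-skew circuit. The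
equations are only needed on a finite set of gates that is closed under taking arguments. -/
theorem ArithCircuit.exists_weaklySkew {k σ α : Type*} {G : Type} [CommSemiring k] [Preorder α]
    (label : G → GateLabel k σ G) (rank : G → α)
    (hrank : ∀ g s a, (label g).arg s = some a → rank a < rank g)
    (hskew : ∀ g l r, label g = .mul l r → (∀ s, (label l).arg s = none) ∧
      ∀ h s, (label h).arg s = some l → h = g ∧ s = true)
    (S : Finset G) (hS : ∀ g ∈ S, ∀ s a, (label g).arg s = some a → a ∈ S)
    (val : G → MvPolynomial σ k)
    (hval : ∀ g ∈ S, val g = match label g with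
      | .const c => MvPolynomial.C c
      | .var x => MvPolynomial.X x
      | .add l r => val l + val r
      | .mul l r => val l * val r)
    (out : G) (hout : out ∈ S) :
    ∃ C : ArithCircuit k σ, C.WeaklySkew ∧ C.poly = val out ∧ C.fatSize ≤ S.card := by
  let R : G → G → Prop := fun a b => ∃ s, (label b).arg s = some a
  -- Keeping only the ancestors of `out` makes it the unique gate of out-degree zero.
  let T : Set G := {g | Relation.ReflTransGen R g out}
  have hTS : ∀ g, Relation.ReflTransGen R g out → g ∈ S := fun g hg => by
    induction hg using Relation.ReflTransGen.head_induction_on with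
    | refl => exact hout
    | head h _ ih => obtain ⟨s, hs⟩ := h; exact hS _ ih s _ hs
  have hT : ∀ g : T, ∀ s a, (label g).arg s = some a → a ∈ T := fun g s a h =>
    Relation.ReflTransGen.head ⟨s, h⟩ g.2
  have harg : ∀ (g : G) {l r}, label g = .add l r ∨ label g = .mul l r →
      (label g).arg true = some l ∧ (label g).arg false = some r := by
    rintro g l r (h | h) <;> simp [h, GateLabel.arg]
  have hlab : ∀ g : T, ∃ L : GateLabel k σ T, label g = match L with
      | .const c => .const c
      | .var x => .var x
      | .add l r => .add l r
      | .mul l r => .mul l r := fun g => by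
    rcases h : label g with c | x | ⟨l, r⟩ | ⟨l, r⟩
    · exact ⟨.const c, rfl⟩
    · exact ⟨.var x, rfl⟩
    · exact ⟨.add ⟨l, hT g _ _ (harg g (.inl h)).1⟩ ⟨r, hT g _ _ (harg g (.inl h)).2⟩, rfl⟩
    · exact ⟨.mul ⟨l, hT g _ _ (harg g (.inr h)).1⟩ ⟨r, hT g _ _ (harg g (.inr h)).2⟩, rfl⟩
  choose lab hlab using hlab
  have hlabarg : ∀ (g : T) s (a : T), (lab g).arg s = some a ↔ (label g).arg s = some ↑a := by
    intro g s a
    rw [hlab g]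
    rcases lab g with c | x | ⟨l, r⟩ | ⟨l, r⟩ <;> cases s <;>
      simp [GateLabel.arg, Subtype.ext_iff]
  have hlt : ∀ a b : T, Relation.TransGen (fun a b => ∃ s, (lab b).arg s = some a) a b →
      rank a < rank b := fun a b h => by
    induction h with
    | single h => obtain ⟨s, hs⟩ := h; exact hrank _ s _ ((hlabarg _ _ _).1 hs)
    | tail _ h ih => obtain ⟨s, hs⟩ := h; exact ih.trans (hrank _ s _ ((hlabarg _ _ _).1 hs))
  have hlt' : ∀ g : T, rank g ≤ rank out := fun ⟨g, hg⟩ => by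
    induction hg using Relation.ReflTransGen.head_induction_on with
    | refl => exact le_rfl
    | head h _ ih => obtain ⟨s, hs⟩ := h; exact (hrank _ s _ hs).le.trans ih
  have hfin : T.Finite := S.finite_toSet.subset fun g hg => hTS g hg
  let C : ArithCircuit k σ :=
    { Gate := T
      fintypeGate := hfin.fintype
      label := lab
      acyclic := fun g h => lt_irrefl _ (hlt g g h)
      output := ⟨out, .refl⟩
      eq_output_iff := by
        intro g
        constructor
        · rintro rfl h s hs
          exact lt_irrefl _ ((hrank _ s _ ((hlabarg _ _ _).1 hs)).trans_le (hlt' h))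
        · intro h
          rcases Relation.ReflTransGen.cases_head g.2 with hg | ⟨b, ⟨s, hs⟩, hb⟩
          · exact Subtype.ext hg
          · exact absurd ((hlabarg ⟨b, hb⟩ s g).2 hs) (h _ _) }
  refine ⟨C, ?_, ?_, ?_⟩
  · intro a l r h
    left
    have hl : label a = .mul l r := by
      have := hlab a
      rwa [show lab a = .mul l r from h] at this
    obtain ⟨h1, h2⟩ := hskew _ _ _ hl
    intro x t y hxy hx _
    -- The left argument is an input, so its sub-circuit is that gate alone.
    have hxl : x = l := by
      rcases Relation.ReflTransGen.cases_tail hx with h | ⟨b, _, s, hs⟩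
      · exact h.symm
      · have := (hlabarg l s b).1 hs
        rw [h1] at this
        cases this
    subst hxl
    obtain ⟨h3, h4⟩ := h2 _ _ ((hlabarg _ _ _).1 hxy)
    exact ⟨rfl, h4, Subtype.ext h3⟩
  · have : ∀ g : T, C.value g = val g := fun g => by
      induction g using C.wellFounded_arrow.induction with
      | _ g ih =>
        rw [C.value_eq, hval g (hTS _ g.2), hlab g]
        have hC : C.label g = lab g := rfl
        rw [hC]
        rcases hg : lab g with c | x | ⟨l, r⟩ | ⟨l, r⟩
        · rfl
        · rfl
        all_goals
          have h1 : C.Arrow l g := ⟨true, by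
            simp [ArithCircuit.ArrowAt, hC, hg, GateLabel.arg]⟩
          have h2 : C.Arrow r g := ⟨false, by
            simp [ArithCircuit.ArrowAt, hC, hg, GateLabel.arg]⟩
          simp only [ih _ h1, ih _ h2]
    exact this _
  · change @Fintype.card T hfin.fintype ≤ _
    rw [Fintype.card_eq_nat_card, ← Set.ncard_coe_finset]
    exact Set.ncard_le_ncard (fun g hg => hTS g hg) S.finite_toSet

/-- The polynomial of an input gate. -/
noncomputable def inputPoly {k σ : Type*} [CommSemiring k] : k ⊕ σ → MvPolynomial σ k :=
  Sum.elim MvPolynomial.C MvPolynomial.X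

/-- The three gates computing `f u + x * f v`, where `x` is an input: the input gate, the
multiplication gate and the addition gate. -/
def skewLabel {k σ V : Type*} (instr : V → k ⊕ V × (k ⊕ σ) × V) :
    V × Fin 3 → GateLabel k σ (V × Fin 3) := fun g =>
  match instr g.1 with
  | .inl c => .const c
  | .inr (u, x, v) =>
    if g.2 = 0 then x.elim .const .var else
    if g.2 = 1 then .mul (g.1, 0) (v, 2) else .add (u, 2) (g.1, 1)

/-- A skew straight-line program, with instructions `f w = c` and `f w = f u + x * f v` for a
constant or variable `x`, gives a weakly-skew circuit. -/
theorem ArithCircuit.exists_weaklySkew_of_instr {k σ α : Type*} {V : Type} [CommSemiring k]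
    [Preorder α] (instr : V → k ⊕ V × (k ⊕ σ) × V) (rank : V → α)
    (hrank : ∀ w u x v, instr w = .inr (u, x, v) → rank u < rank w ∧ rank v < rank w)
    (S : Finset V) (hS : ∀ w ∈ S, ∀ u x v, instr w = .inr (u, x, v) → u ∈ S ∧ v ∈ S)
    (f : V → MvPolynomial σ k) (hf : ∀ w ∈ S, f w =
      (instr w).elim MvPolynomial.C fun t => f t.1 + inputPoly t.2.1 * f t.2.2)
    (out : V) (hout : out ∈ S) :
    ∃ C : ArithCircuit k σ, C.WeaklySkew ∧ C.poly = f out ∧ C.fatSize ≤ S.card * 3 := by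
  have harg : ∀ g s a, (skewLabel instr g).arg s = some a → ∃ u x v,
      instr g.1 = .inr (u, x, v) ∧ (g.2 = 1 ∧ (s = true ∧ a = (g.1, 0) ∨ s = false ∧ a = (v, 2)) ∨
        g.2 = 2 ∧ (s = true ∧ a = (u, 2) ∨ s = false ∧ a = (g.1, 1))) := by
    rintro ⟨w, i⟩ s a h
    rcases hw : instr w with c | ⟨u, x, v⟩
    · simp [skewLabel, hw, GateLabel.arg] at h
    · refine ⟨u, x, v, rfl, ?_⟩
      fin_cases i
      · rcases x with c | x <;> simp [skewLabel, hw, GateLabel.arg] at h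
      · cases s <;> simp_all [skewLabel, GateLabel.arg, eq_comm]
      · cases s <;> simp_all [skewLabel, GateLabel.arg, eq_comm]
  let val : V × Fin 3 → MvPolynomial σ k := fun g =>
    match instr g.1 with
    | .inl c => MvPolynomial.C c
    | .inr (_, x, v) => if g.2 = 0 then inputPoly x else
      if g.2 = 1 then inputPoly x * f v else f g.1
  have hval2 : ∀ w ∈ S, val (w, 2) = f w := fun w hw => by
    have := hf w hw
    rcases h : instr w with c | ⟨u, x, v⟩
    · simp_all [val]
    · simp [val, h]
  refine (ArithCircuit.exists_weaklySkew (skewLabel instr) (fun g => toLex (rank g.1, g.2)) ?_ ?_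
    (S ×ˢ Finset.univ) ?_ val ?_ (out, 2) (by simpa)).imp
    fun C h => ⟨h.1, h.2.1.trans (hval2 _ hout), by simpa using h.2.2⟩
  · intro g s a h
    obtain ⟨u, x, v, hw, h⟩ := harg g s a h
    obtain ⟨hu, hv⟩ := hrank _ _ _ _ hw
    rcases g with ⟨w, i⟩
    rw [Prod.Lex.toLex_lt_toLex]
    rcases h with ⟨rfl, ⟨-, rfl⟩ | ⟨-, rfl⟩⟩ | ⟨rfl, ⟨-, rfl⟩ | ⟨-, rfl⟩⟩ <;> simp_all
  -- The input `(w, 0)` belongs to the instruction of `w` alone and feeds only the product `(w, 1)`.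
  · rintro ⟨w, i⟩ l r h
    have hl := harg (w, i) true l (by simp [h, GateLabel.arg])
    obtain ⟨u, x, v, hw, hl⟩ := hl
    have hw' : instr w = .inr (u, x, v) := hw
    have hi : i = 1 := by
      rcases hl with ⟨rfl, -⟩ | ⟨h2, -⟩
      · rfl
      · obtain rfl : i = 2 := h2
        simp [skewLabel, hw'] at h
    subst hi
    obtain rfl : l = (w, 0) := by simpa using hl
    refine ⟨fun s => ?_, fun g s hg => ?_⟩
    · rcases x with c | x <;> simp [skewLabel, hw', GateLabel.arg]
    · obtain ⟨u', x', v', -, hg⟩ := harg _ _ _ hg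
      rcases g with ⟨w', i'⟩
      rcases hg with ⟨hi, ⟨hs, hg⟩ | ⟨-, hg⟩⟩ | ⟨-, ⟨-, hg⟩ | ⟨-, hg⟩⟩
      · exact ⟨Prod.ext (congrArg Prod.fst hg).symm hi, hs⟩
      all_goals exact absurd (congrArg Prod.snd hg) (by simp)
  · intro g hg s a h
    obtain ⟨u, x, v, hw, h⟩ := harg g s a h
    have hg' : g.1 ∈ S := by simpa using hg
    obtain ⟨hu, hv⟩ := hS _ hg' _ _ _ hw
    rcases h with ⟨-, ⟨-, rfl⟩ | ⟨-, rfl⟩⟩ | ⟨-, ⟨-, rfl⟩ | ⟨-, rfl⟩⟩ <;> simpa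
  · rintro ⟨w, i⟩ hg
    have hw : w ∈ S := by simpa using hg
    have hfw := hf w hw
    rcases h : instr w with c | ⟨u, x, v⟩
    · simp [val, skewLabel, h]
    · obtain ⟨hu, hv⟩ := hS _ hw _ _ _ h
      rw [h, Sum.elim_inr] at hfw
      fin_cases i
      · rcases x with c | x <;> simp [val, skewLabel, h, inputPoly]
      · simp [skewLabel, h, hval2 _ hv]
        simp [val, h]
      · simp [skewLabel, h, hval2 _ hu, hval2 _ hw, hfw]
        simp [val, h]

/-! ### Division-free recursion for the determinant -/

open scoped Matrix

/-- The row vector `y = r * adj D` satisfies `y * D = det D • r`, and gives the determinant of the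
bordered matrix. -/
theorem Matrix.det_fromBlocks_border {R ι : Type*} [CommRing R] [IsDomain R] [Fintype ι]
    [DecidableEq ι] (D : Matrix ι ι R) (c : ι → R) (r : ι → R) (d : R) (hD : D.det ≠ 0) :
    (Matrix.fromBlocks D (Matrix.replicateCol Unit c) (Matrix.replicateRow Unit r)
      (Matrix.of fun _ _ => d)).det = D.det * d - (r ᵥ* D.adjugate) ⬝ᵥ c := by
  have hy : (r ᵥ* D.adjugate) ᵥ* D = D.det • r := by
    rw [Matrix.vecMul_vecMul, Matrix.adjugate_mul, Matrix.vecMul_smul, Matrix.vecMul_one]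
  set y := r ᵥ* D.adjugate
  -- The left factor clears the last row and has determinant `det D`, which is cancelled at the end.
  have hmul : Matrix.fromBlocks 1 0 (-Matrix.replicateRow Unit y)
        (Matrix.of fun _ _ : Unit => D.det) *
      Matrix.fromBlocks D (Matrix.replicateCol Unit c) (Matrix.replicateRow Unit r)
        (Matrix.of fun _ _ => d) =
      Matrix.fromBlocks D (Matrix.replicateCol Unit c) 0
        (Matrix.of fun _ _ => D.det * d - y ⬝ᵥ c) := by
    rw [Matrix.fromBlocks_multiply]
    congr 1
    · simp
    · simp
    · ext i j
      have := congrFun hy j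
      simp only [Matrix.vecMul, dotProduct, Pi.smul_apply, smul_eq_mul] at this
      simp [Matrix.mul_apply, this]
    · ext i j
      simp [Matrix.mul_apply, dotProduct]
      ring
  have := congrArg Matrix.det hmul
  rw [Matrix.det_mul, Matrix.det_fromBlocks_zero₁₂, Matrix.det_fromBlocks_zero₂₁] at this
  simp only [Matrix.det_one, one_mul, Matrix.det_unique, Matrix.of_apply] at this
  exact mul_left_cancel₀ hD this

section leading

variable {R : Type*} [CommRing R]

open Polynomial

/-- The matrix `1 - X * M` for the leading block `M` of size `n` of an infinite matrix. -/
noncomputable def leadingBlock (M : ℕ → ℕ → R) (n : ℕ) : Matrix (Fin n) (Fin n) R[X] :=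
  1 - (X : R[X]) • (Matrix.of fun i j : Fin n => M i j).map C

/-- At `X = 0` the determinant is `1`. -/
theorem det_leadingBlock_ne_zero [Nontrivial R] (M : ℕ → ℕ → R) (n : ℕ) :
    (leadingBlock M n).det ≠ 0 := fun h => by
  have := Matrix.eval_charpolyRev (M := Matrix.of fun i j : Fin n => M i j)
  rw [Matrix.charpolyRev, ← leadingBlock, h] at this
  simp at this

theorem coeff_det_leadingBlock (M : ℕ → ℕ → R) (n : ℕ) :
    (leadingBlock M n).det.coeff n = (-1) ^ n * (Matrix.of fun i j : Fin n => M i j).det := by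
  have h := Polynomial.coeff_det_X_add_C_card (-(Matrix.of fun i j : Fin n => M i j)) 1
  rw [Matrix.det_neg, Fintype.card_fin] at h
  rw [← h, leadingBlock]
  congr 2
  ext1 i j
  by_cases hij : i = j
  · subst hij; simp; ring
  · simp [hij]

/-- The row vector of all `X * (r * adj D)` for the leading block `D`, extended by zero. -/
noncomputable def borderRow (M : ℕ → ℕ → R) (n j : ℕ) : R[X] :=
  if h : j < n then
    X * ((fun i : Fin n => C (M n i)) ᵥ* (leadingBlock M n).adjugate) ⟨j, h⟩
  else 0

/-- The first `i` summands of the expression for the entry `j` of the border row. -/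
noncomputable def borderSum (M : ℕ → ℕ → R) (n j i : ℕ) : R[X] :=
  X * ((leadingBlock M n).det * C (M n j) +
    ∑ l ∈ Finset.range i, borderRow M n l * C (M l j))

/-- With `y = r adj D` and `D = 1 - X M`, the identity `y D = det D • r` reads `X y = X (det D • r +
(X y) M)`. The outer `X` makes it a recursion on coefficients. -/
theorem borderSum_eq_borderRow (M : ℕ → ℕ → R) {n j : ℕ} (hj : j < n) :
    borderSum M n j n = borderRow M n j := by
  set r : Fin n → R[X] := fun i => C (M n i)
  have hy : (r ᵥ* (leadingBlock M n).adjugate) ᵥ* leadingBlock M n =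
      (leadingBlock M n).det • r := by
    rw [Matrix.vecMul_vecMul, Matrix.adjugate_mul, Matrix.vecMul_smul, Matrix.vecMul_one]
  have hb : ∀ l : Fin n, borderRow M n l = X * (r ᵥ* (leadingBlock M n).adjugate) l := fun l => by
    simp [borderRow, r]
  rw [borderSum, Finset.sum_range, hb ⟨j, hj⟩]
  simp_rw [hb]
  set y := r ᵥ* (leadingBlock M n).adjugate
  have h := congrFun hy ⟨j, hj⟩
  rw [leadingBlock, Matrix.vecMul_sub, Matrix.vecMul_one, Matrix.vecMul_smul] at h
  simp only [Pi.sub_apply, Pi.smul_apply, smul_eq_mul, Matrix.vecMul, dotProduct, Matrix.map_apply,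
    Matrix.of_apply] at h
  rw [← leadingBlock] at h
  have h2 : ∑ l : Fin n, X * y l * C (M l j) = X * ∑ l : Fin n, y l * C (M l j) := by
    rw [Finset.mul_sum]
    exact Finset.sum_congr rfl fun _ _ => by ring
  rw [h2]
  simp only [r] at h
  linear_combination (-X : R[X]) * h

theorem det_leadingBlock_succ [IsDomain R] (M : ℕ → ℕ → R) (n : ℕ) :
    (leadingBlock M (n + 1)).det = (leadingBlock M n).det - borderSum M n n n := by
  have hb : ∀ l : Fin n, borderRow M n l =
      X * ((fun i : Fin n => C (M n i)) ᵥ* (leadingBlock M n).adjugate) l := fun l => by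
    simp [borderRow]
  let e : Fin n ⊕ Unit ≃ Fin (n + 1) :=
    (Equiv.sumCongr (Equiv.refl _) (Equiv.ofUnique Unit (Fin 1))).trans finSumFinEquiv
  have he : (leadingBlock M (n + 1)).submatrix e e = Matrix.fromBlocks (leadingBlock M n)
      (Matrix.replicateCol Unit fun i : Fin n => -X * C (M i n))
      (Matrix.replicateRow Unit ((-X : R[X]) • fun i : Fin n => C (M n i)))
      (Matrix.of fun _ _ => 1 - X * C (M n n)) := by
    ext1 i j
    rcases i with i | i <;> rcases j with j | j
    · simp [leadingBlock, e, Matrix.one_apply, Fin.ext_iff]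
    · have : (i : ℕ) ≠ n := i.2.ne
      simp [leadingBlock, e, Fin.ext_iff, this]
    · have : n ≠ (j : ℕ) := j.2.ne'
      simp [leadingBlock, e, Fin.ext_iff, this]
    · simp [leadingBlock, e]
  rw [← Matrix.det_submatrix_equiv_self e, he,
    Matrix.det_fromBlocks_border _ _ _ _ (det_leadingBlock_ne_zero M n), Matrix.smul_vecMul,
    borderSum, Finset.sum_range]
  simp_rw [hb]
  simp only [dotProduct, Pi.smul_apply, smul_eq_mul, mul_add, Finset.mul_sum, mul_sub]
  have : ∀ a b c : R[X], a - b - c = a - (b + c) := fun a b c => by ring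
  rw [mul_one, this]
  congr 2
  · ring
  · exact Finset.sum_congr rfl fun _ _ => by ring

end leading

/-- The nodes of the straight-line program for the determinant: `p n m` is the coefficient of
`X ^ m` of the determinant of the leading block of size `n`, and `y n m j i` that of the partial
border sum. -/
inductive DetNode
  | p (n m : ℕ)
  | y (n m j i : ℕ)

namespace DetNode

/-- The instructions of the program; `a` is the constant from which it starts. -/
def instr {k σ : Type*} [CommRing k] (a : k) (M : ℕ → ℕ → k ⊕ σ) :
    DetNode → k ⊕ DetNode × (k ⊕ σ) × DetNode
  | p 0 0 => .inl a
  | p 0 (_ + 1) => .inl 0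
  | p (n + 1) m => .inr (p n m, .inl (-1), y n m n n)
  | y _ 0 _ _ => .inl 0
  -- The node `y 0 0 0 0` has value zero and only fills the additive slot.
  | y n (m + 1) j 0 => .inr (y 0 0 0 0, M n j, p n m)
  -- For `i < n` the complete sum `y n m i n` is the coefficient of the border row at `i`.
  | y n (m + 1) j (i + 1) => .inr (y n (m + 1) j i, M i j, y n m i n)

/-- A measure that decreases from a node to the arguments of its instruction. -/
def rank : DetNode → ℕ ×ₗ ℕ ×ₗ ℕ
  | p n _ => toLex (2 * n, toLex (0, 0))
  | y n m _ i => toLex (2 * n + 1, toLex (m, i))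

theorem rank_lt {k σ : Type*} [CommRing k] (a : k) (M : ℕ → ℕ → k ⊕ σ) (w u : DetNode)
    (x : k ⊕ σ) (v : DetNode) (h : instr a M w = .inr (u, x, v)) :
    rank u < rank w ∧ rank v < rank w := by
  rcases w with ⟨_ | n, _ | m⟩ | ⟨n, _ | m, j, _ | i⟩ <;>
    simp only [instr, Sum.inr.injEq, Prod.mk.injEq, reduceCtorEq] at h <;>
    obtain ⟨rfl, -, rfl⟩ := h <;>
    simp only [rank, Prod.Lex.toLex_lt_toLex, true_and] <;> omega

/-- The nodes that are needed for a determinant of size `N`. -/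
noncomputable def nodes (N : ℕ) : Finset DetNode :=
  open Classical in
  (Finset.range (N + 1) ×ˢ Finset.range (N + 1)).image (fun t => p t.1 t.2) ∪
    ((Finset.range (N + 1) ×ˢ Finset.range (N + 1) ×ˢ Finset.range (N + 1) ×ˢ
      Finset.range (N + 1)).filter fun t => t.2.2.2 ≤ t.1).image
        fun t => y t.1 t.2.1 t.2.2.1 t.2.2.2

theorem p_mem_nodes {N n m : ℕ} : p n m ∈ nodes N ↔ n ≤ N ∧ m ≤ N := by
  simp [nodes]

theorem y_mem_nodes {N n m j i : ℕ} :
    y n m j i ∈ nodes N ↔ n ≤ N ∧ m ≤ N ∧ j ≤ N ∧ i ≤ n := by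
  simp only [nodes, Finset.mem_union, Finset.mem_image, Finset.mem_filter, Finset.mem_product,
    Finset.mem_range, Prod.exists, reduceCtorEq, and_false, exists_false, false_or, y.injEq]
  constructor
  · rintro ⟨n, m, j, i, h, rfl, rfl, rfl, rfl⟩
    omega
  · intro h
    exact ⟨n, m, j, i, by omega, rfl, rfl, rfl, rfl⟩

theorem card_nodes_le (N : ℕ) : (nodes N).card ≤ (N + 1) ^ 2 + (N + 1) ^ 4 := by
  classical
  refine (Finset.card_union_le _ _).trans (add_le_add ?_ ?_)
  · exact Finset.card_image_le.trans (by simp [sq])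
  · refine Finset.card_image_le.trans ((Finset.card_filter_le _ _).trans ?_)
    simp only [Finset.card_product, Finset.card_range]
    exact le_of_eq (by ring)

theorem instr_mem_nodes {k σ : Type*} [CommRing k] (a : k) (M : ℕ → ℕ → k ⊕ σ) (N : ℕ)
    (w : DetNode) (hw : w ∈ nodes N) (u : DetNode) (x : k ⊕ σ) (v : DetNode)
    (h : instr a M w = .inr (u, x, v)) : u ∈ nodes N ∧ v ∈ nodes N := by
  rcases w with ⟨_ | n, _ | m⟩ | ⟨n, _ | m, j, _ | i⟩ <;>
    simp only [instr, Sum.inr.injEq, Prod.mk.injEq, reduceCtorEq] at h <;>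
    obtain ⟨rfl, -, rfl⟩ := h <;>
    simp only [p_mem_nodes, y_mem_nodes] at hw ⊢ <;> omega

/-- The polynomials computed by the program. -/
noncomputable def val {k σ : Type*} [CommRing k] (a : k) (M : ℕ → ℕ → k ⊕ σ) :
    DetNode → MvPolynomial σ k
  | p n m => MvPolynomial.C a * (leadingBlock (fun i j => inputPoly (M i j)) n).det.coeff m
  | y n m j i => MvPolynomial.C a * (borderSum (fun i j => inputPoly (M i j)) n j i).coeff m

theorem val_eq {k σ : Type*} [CommRing k] [IsDomain k] (a : k) (M : ℕ → ℕ → k ⊕ σ) (N : ℕ)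
    (w : DetNode) (hw : w ∈ nodes N) : val a M w =
      (instr a M w).elim MvPolynomial.C fun t => val a M t.1 + inputPoly t.2.1 * val a M t.2.2 := by
  have hy0 : ∀ n j i, val a M (y n 0 j i) = 0 := fun n j i => by simp [val, borderSum]
  rcases w with ⟨_ | n, m⟩ | ⟨n, _ | m, j, _ | i⟩
  · rcases m with _ | m <;> simp [val, instr, Polynomial.coeff_one]
  · simp only [val, instr, Sum.elim_inr, det_leadingBlock_succ, Polynomial.coeff_sub]
    simp [inputPoly]
    ring
  · simp [hy0, instr]
  · simp [hy0, instr]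
  · simp only [instr, Sum.elim_inr, hy0]
    simp [val, borderSum, Polynomial.coeff_X_mul]
    ring
  · have hi : i < n := by
      rw [y_mem_nodes] at hw
      omega
    simp only [instr, Sum.elim_inr, val, borderSum_eq_borderRow _ hi]
    simp only [borderSum, Finset.sum_range_succ, Polynomial.coeff_X_mul, Polynomial.coeff_add,
      Polynomial.coeff_mul_C]
    ring

end DetNode

/-- The determinant of a matrix of constants and variables is computed by a weakly-skew circuit
of polynomial size. -/
theorem exists_weaklySkew_det {k σ : Type*} [CommRing k] [IsDomain k] {N : ℕ}
    (A : Matrix (Fin N) (Fin N) (MvPolynomial σ k))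
    (hA : ∀ i j, (∃ c, A i j = MvPolynomial.C c) ∨ ∃ x, A i j = MvPolynomial.X x) :
    ∃ C : ArithCircuit k σ, C.WeaklySkew ∧ C.poly = A.det ∧
      C.fatSize ≤ ((N + 1) ^ 2 + (N + 1) ^ 4) * 3 := by
  have hA' : ∀ i j, ∃ x, inputPoly x = A i j := fun i j => by
    rcases hA i j with ⟨c, h⟩ | ⟨x, h⟩
    · exact ⟨.inl c, h.symm⟩
    · exact ⟨.inr x, h.symm⟩
  choose L hL using hA'
  let M : ℕ → ℕ → k ⊕ σ := fun i j =>
    if h : i < N ∧ j < N then L ⟨i, h.1⟩ ⟨j, h.2⟩ else .inl 0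
  -- Starting from `(-1) ^ N` scales the whole program and cancels the sign of the top coefficient.
  obtain ⟨C, h1, h2, h3⟩ := ArithCircuit.exists_weaklySkew_of_instr
    (DetNode.instr ((-1) ^ N) M) DetNode.rank (DetNode.rank_lt _ M) (DetNode.nodes N)
    (DetNode.instr_mem_nodes _ M N) (DetNode.val ((-1) ^ N) M) (DetNode.val_eq ((-1) ^ N) M N)
    (.p N N) (by simp [DetNode.p_mem_nodes])
  refine ⟨C, h1, h2.trans ?_, h3.trans (Nat.mul_le_mul_right 3 (DetNode.card_nodes_le N))⟩
  have hM : (Matrix.of fun i j : Fin N => inputPoly (M i j)) = A := by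
    ext1 i j
    simp [M, hL]
  rw [DetNode.val, coeff_det_leadingBlock, hM, ← mul_assoc, map_pow, map_neg, map_one, ← mul_pow]
  simp

/-- Projections of determinants of polynomially bounded size form a family in `VP_ws`. -/
theorem inVPws_of_isProjectionOf_det {k : Type*} [CommRing k] [IsDomain k] {σ : ℕ → Type*}
    (f : ∀ n, MvPolynomial (σ n) k) (q : Polynomial ℕ)
    (hf : ∀ n, IsProjectionOf (f n) (detPoly k (q.eval n))) : InVPws f := by
  refine ⟨((q + 1) ^ 2 + (q + 1) ^ 4) * 3, fun n => ?_⟩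
  obtain ⟨a, ha, hfa⟩ := hf n
  obtain ⟨C, h1, h2, h3⟩ := exists_weaklySkew_det
    (Matrix.of fun i j => a (i, j)) fun i j => ha (i, j)
  refine ⟨C, h1, h2.trans ?_, by simpa using h3⟩
  rw [hfa, detPoly, AlgHom.map_det]
  congr 1
  ext1 i j
  simp [Matrix.mvPolynomialX_apply]

theorem mainTheorem9 (k : Type*) [Field k] [CharP k 2] :
    InVPws (fun n => perStar k n ^ 2) ∧
      ∀ n : ℕ, IsProjectionOf (perStar k n ^ 2) (detPoly k (2 * n)) := by
  exact ⟨inVPws_of_isProjectionOf_det _ (2 * Polynomial.X) fun n => by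
    rw [show (2 * Polynomial.X : Polynomial ℕ).eval n = 2 * n by simp]
    exact perStar_sq_isProjectionOf k n, perStar_sq_isProjectionOf k⟩
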